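/- Let $G$ be a finitely generated nilpotent group. For a subgroup $H\subseteq G$ let $H^{*}$ be the smallest subgroup of $G$ that contains $H$ and is closed under roots (if $g^{i}\in H^{*}$ for some $i\geq 1$, then $g\in H^{*}$). An irreducible weight pair is a pair $(H,\chi)$ of a subgroup $H\subseteq G$ and a character $\chi\colon H\to\mathbb{C}^{*}$ such that the finitely induced representation $\operatorname{ind}_H^G(\chi)=\mathbb{C}[G]\otimes_{\mathbb{C}[H]}\chi$ is irreducible; write $(H_1,\chi_1)\sim(H_2,\chi_2)$ if $\operatorname{ind}_{H_1}^G(\chi_1)\simeq\operatorname{ind}_{H_2}^G(\chi_2)$. Let $Y$ be the set of irreducible weight pairs and let $\Sigma$ be the set of subgroups $H$ that occur in such pairs. For $H\in\Sigma$ let $Y_H$ be the fibre of $Y\to\Sigma$ over $H$, let $Z_H=Y_H/\!\sim$, and let $Z=\bigsqcup_{H\in\Sigma}Z_H$. Let $W=Y/\!\sim_{*}$, where $(H_1,\chi_1)\sim_{*}(H_2,\chi_2)$ means that $(H_1,\chi_1)\sim(H_2,\chi_2)$ and $H_1^{*}=H_2^{*}$. Let $\varphi\colon Z\to W$ be the natural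 map that sends the class of $(H,\chi)$ in $Z_H$ to its class in $W$. Then for every $w\in W$ the fibre $\varphi^{-1}(w)\subseteq Z$ is finite. Equivalently, for every irreducible weight pair $(H,\chi)$ there are only finitely many classes in $Z$ of irreducible weight pairs $(H',\chi')$ with $(H',\chi')\sim(H,\chi)$ and $H'^{*}=H^{*}$. -/

import Mathlib

namespace WeightPairs

/-- The one-dimensional complex representation on `ℂ` given by a character `χ : H → ℂˣ`. -/
noncomputable def charRep {H : Type*} [Group H] (χ : H →* ℂˣ) : Representation ℂ H ℂ where
  toFun h := LinearMap.lsmul ℂ ℂ (χ h : ℂ)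
  map_one' := by ext; simp
  map_mul' a b := by ext; simp

/-- The finitely induced representation `ind_H^G(χ)`, i.e. `ℂ[G] ⊗_{ℂ[H]} χ`. -/
noncomputable abbrev indChar {G : Type*} [Group G] (H : Subgroup G) (χ : H →* ℂˣ) :
    Representation ℂ G (Representation.IndV H.subtype (charRep χ)) :=
  Representation.ind H.subtype (charRep χ)

/-- A subgroup `K` is closed under taking roots in `G`. -/
def RootClosed {G : Type*} [Group G] (K : Subgroup G) : Prop :=
  ∀ (g : G) (i : ℕ), 0 < i → g ^ i ∈ K → g ∈ K

/-- `H^*`, the smallest subgroup of `G` that contains `H` and is closed under taking roots. -/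
def isolator {G : Type*} [Group G] (H : Subgroup G) : Subgroup G :=
  sInf {K : Subgroup G | H ≤ K ∧ RootClosed K}

theorem isolator_isLeast {G : Type*} [Group G] (H : Subgroup G) :
    IsLeast {K : Subgroup G | H ≤ K ∧ RootClosed K} (isolator H) := by
  refine ⟨⟨le_sInf fun K hK => hK.1, fun g i hi hg => ?_⟩, fun K hK => sInf_le hK⟩
  rw [isolator, Subgroup.mem_sInf] at hg ⊢
  exact fun K hK => hK.2 g i hi (hg K hK)

/-- The set `Y` of irreducible weight pairs `(H, χ)` of `G`. -/
structure Y (G : Type*) [Group G] where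
  subgroup : Subgroup G
  character : subgroup →* ℂˣ
  irreducible : (indChar subgroup character).IsIrreducible

/-- Equivalence of weight pairs: the induced representations are isomorphic. -/
def Equivalent {G : Type*} [Group G] (p q : Y G) : Prop :=
  Nonempty ((indChar p.subgroup p.character).Equiv (indChar q.subgroup q.character))

theorem equivalent_equivalence (G : Type*) [Group G] :
    Equivalence (Equivalent : Y G → Y G → Prop) :=
  ⟨fun _ => ⟨Representation.Equiv.refl _⟩, fun ⟨e⟩ => ⟨e.symm⟩, fun ⟨e⟩ ⟨f⟩ => ⟨e.trans f⟩⟩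

/-- The set of subgroups `H` of `G` (the base, usually denoted by a capital sigma) for which there
is a character `χ` such that `(H, χ)` is an irreducible weight pair. -/
def Base (G : Type*) [Group G] : Type _ :=
  {H : Subgroup G // ∃ χ : H →* ℂˣ, (indChar H χ).IsIrreducible}

/-- The natural surjection from `Y` to the base. -/
def toBase {G : Type*} [Group G] (p : Y G) : Base G :=
  ⟨p.subgroup, p.character, p.irreducible⟩

/-- The fibre `Y_H` of `Y` over a subgroup `H` in the base. -/
def YFibre {G : Type*} [Group G] (H : Base G) : Type _ :=
  {p : Y G // toBase p = H}

/-- The equivalence `∼_f` on the fibre `Y_H`. -/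
def fibreSetoid {G : Type*} [Group G] (H : Base G) : Setoid (YFibre H) where
  r p q := Equivalent p.1 q.1
  iseqv := (equivalent_equivalence G).comap Subtype.val

/-- The bundle `Z` over the base, with fibre `Z_H = Y_H / ∼_f` over `H`. -/
def Z (G : Type*) [Group G] : Type _ :=
  (H : Base G) × Quotient (fibreSetoid H)

/-- The equivalence `∼_*` on `Y`: the pairs are equivalent and `H₁^* = H₂^*`. -/
def starSetoid (G : Type*) [Group G] : Setoid (Y G) where
  r p q := Equivalent p q ∧ isolator p.subgroup = isolator q.subgroup
  iseqv :=
    ⟨fun p => ⟨(equivalent_equivalence G).refl p, rfl⟩,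
      fun h => ⟨(equivalent_equivalence G).symm h.1, h.2.symm⟩,
      fun h k => ⟨(equivalent_equivalence G).trans h.1 k.1, h.2.trans k.2⟩⟩

/-- The quotient `W = Y / ∼_*`. -/
def W (G : Type*) [Group G] : Type _ :=
  Quotient (starSetoid G)

theorem isolator_eq_of_fibre {G : Type*} [Group G] {H : Base G} (p q : YFibre H) :
    isolator p.1.subgroup = isolator q.1.subgroup := by
  have hp : p.1.subgroup = H.1 := congrArg Subtype.val p.2
  have hq : q.1.subgroup = H.1 := congrArg Subtype.val q.2
  rw [hp, hq]

/-- The natural map `φ : Z → W`, sending the class of `(H, χ)` in `Z_H` to its class in `W`. -/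
def phi {G : Type*} [Group G] (z : Z G) : W G :=
  Quotient.lift (s := fibreSetoid z.1) (fun p : YFibre z.1 => (Quotient.mk (starSetoid G) p.1 : W G))
    (fun p q h => Quotient.sound (s := starSetoid G) ⟨h, isolator_eq_of_fibre p q⟩) z.2

end WeightPairs

/-!
Fix `(H, χ)` and put `K = H^*`. Two facts reduce the theorem to a comparison of indices: all
subgroups of `G` are finitely generated, so that `K` has only finitely many subgroups of a given
finite index, and every subgroup has finite index in its isolator. It then suffices to show
`[K : H'] ≤ [K : H]` whenever `(H', χ')` is an irreducible weight pair with `H'^* = K` and an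
isomorphism `f` from `ind_{H'}^G(χ')` to `ind_H^G(χ)`.

View induced representations as spaces of functions on `G`, and let `g` be a point at which the
image under `f` of the canonical generator does not vanish. The support of this image meets only
finitely many cosets of `H` and is stable under `H'` on the right, so `g K g⁻¹` consists of elements
with a power in `H`, whence `g K g⁻¹ ≤ K`. Hence `u ↦ (f u)|_{Kg}`, on the copy of
`ind_{H'}^K(χ')` formed by the functions supported on `K`, has a `K`-stable kernel. This kernel
misses the generator and is therefore zero, because the `G`-translates of a nonzero `K`-stable
subspace span `ind_{H'}^G(χ')`. The source has dimension `[K : H']`, and the functions on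
`Kg` that transform by `χ` under `H` form a space of dimension `[K : H]`.

Both facts on a nilpotent group are proved by dividing out the last nontrivial term of the lower
central series. It is central and generated by commutators, and `⁅x ^ m, y ^ n⁆ = ⁅x, y⁆ ^ (m * n)`
whenever `⁅x, y⁆` is central, so powers of generators lying in `H` propagate to it.
-/

namespace WeightPairs

open Subgroup
open scoped commutatorElement

section NilpotentGroups

universe u

variable {G G' : Type*} [Group G] [Group G']

theorem exists_fg_le_map_eq (f : G →* G') {H : Subgroup G} (h : (H.map f).FG) :
    ∃ L ≤ H, L.FG ∧ L.map f = H.map f := by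
  classical
  obtain ⟨T, hT⟩ := h
  have hTH : (T : Set G') ⊆ f '' (H : Set G) := by
    rw [← coe_map, ← hT]
    exact subset_closure
  obtain ⟨S, hSH, rfl⟩ := Finset.subset_set_image_iff.1 hTH
  refine ⟨Subgroup.closure S, (closure_le H).2 hSH, ⟨S, rfl⟩, ?_⟩
  rw [MonoidHom.map_closure, ← Finset.coe_image, hT]

theorem fg_of_fg_map_of_fg_inf_ker (f : G →* G') {H : Subgroup G} (hmap : (H.map f).FG)
    (hker : (H ⊓ f.ker).FG) : H.FG := by
  obtain ⟨L, hLH, hL, hLmap⟩ := exists_fg_le_map_eq f hmap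
  have hH : L ⊔ H ⊓ f.ker = H := by
    refine le_antisymm (sup_le hLH inf_le_left) fun x hx => ?_
    obtain ⟨y, hy, hxy⟩ : f x ∈ L.map f := hLmap ▸ mem_map_of_mem f hx
    have hyx : y⁻¹ * x ∈ H ⊓ f.ker :=
      ⟨H.mul_mem (H.inv_mem (hLH hy)) hx, by simp [hxy]⟩
    rw [← mul_inv_cancel_left y x]
    exact mul_mem_sup hy hyx
  exact hH ▸ hL.sup hker

theorem subgroup_fg_of_comm {A : Type*} [CommGroup A] [Group.FG A] (B : Subgroup A) : B.FG := by
  have : Module.Finite ℤ (Additive A) := Module.Finite.iff_addGroup_fg.2 inferInstance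
  have hB := IsNoetherian.noetherian (AddSubgroup.toIntSubmodule B.toAddSubgroup)
  rwa [Submodule.fg_iff_addSubgroup_fg, AddSubgroup.toIntSubmodule_toAddSubgroup,
    ← fg_iff_add_fg] at hB

open scoped IsMulCommutative in
theorem fg_of_le_of_isMulCommutative {A B : Subgroup G} [IsMulCommutative A] (hA : A.FG)
    (hBA : B ≤ A) : B.FG := by
  have : Group.FG A := (Group.fg_iff_subgroup_fg A).2 hA
  have : Group.FG (B.subgroupOf A) := (Group.fg_iff_subgroup_fg _).2 (subgroup_fg_of_comm _)
  let e := subgroupOfEquivOfLe hBA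
  exact (Group.fg_iff_subgroup_fg B).1 (Group.fg_of_surjective (f := e.toMonoidHom) e.surjective)

theorem commutator_closure_closure_le {S T : Set G} {N : Subgroup G} [N.Normal]
    (h : ∀ s ∈ S, ∀ t ∈ T, ⁅s, t⁆ ∈ N) : ⁅Subgroup.closure S, Subgroup.closure T⁆ ≤ N := by
  rw [← QuotientGroup.ker_mk' N, ← Subgroup.map_eq_bot_iff, map_commutator, MonoidHom.map_closure,
    MonoidHom.map_closure, commutator_eq_bot_iff_le_centralizer, centralizer_closure, closure_le]
  rintro _ ⟨s, hs, rfl⟩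
  rw [SetLike.mem_coe, mem_centralizer_iff]
  rintro _ ⟨t, ht, rfl⟩
  rw [eq_comm, ← commutatorElement_eq_one_iff_mul_comm, ← map_commutatorElement,
    ← MonoidHom.mem_ker, QuotientGroup.ker_mk']
  exact h s hs t ht

theorem normal_of_le_center {N : Subgroup G} (hN : N ≤ center G) : N.Normal :=
  commutator_top_right_le_iff.1
    ((commutator_top_right_eq_bot_iff_le_center.2 hN).le.trans bot_le)

theorem fg_commutator_of_le_center {A B : Subgroup G} (hA : A.FG) (hB : B.FG)
    (h : ⁅A, B⁆ ≤ center G) : ⁅A, B⁆.FG := by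
  classical
  obtain ⟨S, rfl⟩ := hA
  obtain ⟨T, rfl⟩ := hB
  have hle : Subgroup.closure (Set.image2 (fun s t => ⁅s, t⁆) (S : Set G) T) ≤
      ⁅Subgroup.closure (S : Set G), Subgroup.closure (T : Set G)⁆ := by
    rw [closure_le, Set.image2_subset_iff]
    exact fun s hs t ht =>
      commutator_mem_commutator (subset_closure hs) (subset_closure ht)
  have := normal_of_le_center (hle.trans h)
  refine ⟨Finset.image₂ (fun s t => ⁅s, t⁆) S T, ?_⟩
  rw [Finset.coe_image₂]
  exact hle.antisymm (commutator_closure_closure_le fun s hs t ht =>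
    subset_closure (Set.mem_image2_of_mem hs ht))

theorem commutator_sup_center_left (A B : Subgroup G) : ⁅A ⊔ center G, B⁆ = ⁅A, B⁆ := by
  refine le_antisymm (commutator_le.2 fun x hx g hg => ?_) (commutator_mono le_sup_left le_rfl)
  obtain ⟨a, ha, z, hz, rfl⟩ := mem_sup_of_normal_right.1 hx
  have hzg : ⁅z, g⁆ = 1 :=
    commutatorElement_eq_one_iff_mul_comm.2 (mem_center_iff.1 hz g).symm
  rw [commutatorElement_mul_left_eq_conj_mul, hzg, mul_one, mul_inv_cancel, one_mul]
  exact commutator_mem_commutator ha hg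

theorem fg_commutator_of_fg_map (f : G →* G') (hf : f.ker ≤ center G) {A B : Subgroup G}
    (hA : (A.map f).FG) (hB : B.FG) (h : ⁅A, B⁆ ≤ center G) : ⁅A, B⁆.FG := by
  obtain ⟨L, hLA, hL, hLmap⟩ := exists_fg_le_map_eq f hA
  have hAL : A ≤ L ⊔ center G := (map_le_map_iff.1 hLmap.ge).trans (sup_le_sup_left hf L)
  have hcomm : ⁅A, B⁆ = ⁅L, B⁆ :=
    ((commutator_mono hAL le_rfl).trans_eq (commutator_sup_center_left L B)).antisymm
      (commutator_mono hLA le_rfl)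
  rw [hcomm] at h ⊢
  exact fg_commutator_of_le_center hL hB h

theorem commutator_sup_center_right (A B : Subgroup G) : ⁅A, B ⊔ center G⁆ = ⁅A, B⁆ := by
  rw [commutator_comm, commutator_sup_center_left, commutator_comm]

theorem nilpotent_commutator_quotient_ind {P : ∀ (G : Type u) [Group G], Prop}
    (comm : ∀ (G : Type u) [Group G], commutator G = ⊥ → P G)
    (central : ∀ (G : Type u) [Group G] (A : Subgroup G) [A.Normal], ⁅A, ⊤⁆ ≤ center G →
      P (G ⧸ ⁅A, (⊤ : Subgroup G)⁆) → P G)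
    (G : Type u) [Group G] [Group.IsNilpotent G] : P G := by
  obtain ⟨n, hn⟩ := Subgroup.nilpotent_iff_lowerCentralSeries.1 ‹Group.IsNilpotent G›
  have hn : (⊤ : Subgroup G).lowerCentralSeries (n + 1) = ⊥ :=
    eq_bot_iff.2 ((Subgroup.lowerCentralSeries_antitone _ n.le_succ).trans hn.le)
  clear * - comm central hn
  induction n generalizing G with
  | zero => exact comm G hn
  | succ n ih =>
    let A := (⊤ : Subgroup G).lowerCentralSeries n
    have hA : ⁅A, ⊤⁆ ≤ center G := commutator_top_right_eq_bot_iff_le_center.1 hn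
    refine central G A hA (ih _ ?_)
    rw [← map_top_of_surjective _ (QuotientGroup.mk'_surjective ⁅A, (⊤ : Subgroup G)⁆),
      ← map_lowerCentralSeries]
    exact QuotientGroup.map_mk'_self _

theorem subgroup_fg_of_isNilpotent [Group.FG G] [Group.IsNilpotent G] (H : Subgroup G) :
    H.FG := by
  refine nilpotent_commutator_quotient_ind (P := fun G _ => Group.FG G → ∀ H : Subgroup G, H.FG)
    (fun G _ hG _ H => ?_) (fun G _ A _ hA ih _ H => ?_) G inferInstance H
  · have : IsMulCommutative (⊤ : Subgroup G) := commutator_self_eq_bot_iff.1 hG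
    exact fg_of_le_of_isMulCommutative Group.FG.out le_top
  · let q := QuotientGroup.mk' ⁅A, (⊤ : Subgroup G)⁆
    have hq : q.ker = ⁅A, ⊤⁆ := QuotientGroup.ker_mk' _
    have hfg : ⁅A, (⊤ : Subgroup G)⁆.FG :=
      fg_commutator_of_fg_map q (hq.trans_le hA) (ih inferInstance _) Group.FG.out hA
    have : IsMulCommutative (⁅A, ⊤⁆ : Subgroup G) :=
      le_centralizer_iff_isMulCommutative.1 (hA.trans (center_le_centralizer _))
    exact fg_of_fg_map_of_fg_inf_ker q (ih inferInstance _)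
      (fg_of_le_of_isMulCommutative hfg (inf_le_right.trans_eq hq))

open scoped IsMulCommutative in
theorem finiteIndex_of_pow_mem_of_commutator_le [Group.FG G] {N : Subgroup G}
    (hN : _root_.commutator G ≤ N) {S : Set G} (hS : Subgroup.closure S = ⊤)
    (h : ∀ s ∈ S, ∃ m : ℕ, 0 < m ∧ s ^ m ∈ N) : N.FiniteIndex := by
  have : N.Normal := Normal.of_commutator_le G hN
  let q := QuotientGroup.mk' N
  have : IsMulCommutative (G ⧸ N) := Normal.quotient_commutative_iff_commutator_le.2 hN
  have hq : Subgroup.closure (q '' S) = ⊤ := by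
    rw [← MonoidHom.map_closure, hS, map_top_of_surjective q (QuotientGroup.mk'_surjective N)]
  have htors : CommGroup.torsion (G ⧸ N) = ⊤ := by
    rw [eq_top_iff, ← hq, closure_le]
    rintro _ ⟨s, hs, rfl⟩
    obtain ⟨m, hm, hsm⟩ := h s hs
    exact isOfFinOrder_iff_pow_eq_one.2 ⟨m, hm, (QuotientGroup.eq_one_iff (s ^ m)).2 hsm⟩
  have : Finite (G ⧸ N) := CommGroup.finite_of_fg_isMulTorsion _ fun x =>
    show x ∈ CommGroup.torsion (G ⧸ N) from htors ▸ mem_top x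
  exact finiteIndex_of_finite_quotient

theorem commutatorElement_pow_left_of_mem_center {x g : G} (h : ⁅x, g⁆ ∈ center G) (n : ℕ) :
    ⁅x ^ n, g⁆ = ⁅x, g⁆ ^ n := by
  induction n with
  | zero => simp
  | succ n ih =>
    rw [pow_succ, commutatorElement_mul_left_eq_conj_mul, ih, mem_center_iff.1 h,
      mul_inv_cancel_right, pow_succ']

theorem commutatorElement_pow_pow_of_mem_center {x g : G} (h : ⁅x, g⁆ ∈ center G) (m n : ℕ) :
    ⁅x ^ m, g ^ n⁆ = ⁅x, g⁆ ^ (m * n) := by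
  have hgx : ⁅g, x⁆ ∈ center G := by rwa [← commutatorElement_inv, inv_mem_iff]
  have hxg : ⁅x, g ^ n⁆ = ⁅x, g⁆ ^ n := by
    rw [← commutatorElement_inv, commutatorElement_pow_left_of_mem_center hgx, ← inv_pow,
      commutatorElement_inv]
  rw [commutatorElement_pow_left_of_mem_center (hxg ▸ pow_mem h n), hxg, ← pow_mul, mul_comm]

theorem relIndex_sup_of_le_normalizer {H N : Subgroup G} (h : N ≤ normalizer H) :
    H.relIndex (N ⊔ H) = H.relIndex N := by
  have := normal_subgroupOf_of_le_normalizer h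
  have := normal_subgroupOf_sup_of_le_normalizer h
  exact (Nat.card_congr (QuotientGroup.quotientInfEquivProdNormalizerQuotient N H h).toEquiv).symm

theorem commutator_le_of_le_sup_center {A B H : Subgroup G} (hA : A ≤ H ⊔ center G)
    (hB : B ≤ H ⊔ center G) : ⁅A, B⁆ ≤ H :=
  calc ⁅A, B⁆ ≤ ⁅H ⊔ center G, H ⊔ center G⁆ := commutator_mono hA hB
    _ = ⁅H, H⁆ := by rw [commutator_sup_center_left, commutator_sup_center_right]
    _ ≤ H := commutator_le_self H

theorem map_sup_commutator {f : G →* G'} (hf : Function.Surjective f) (H : Subgroup G) :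
    (H ⊔ _root_.commutator G).map f = H.map f ⊔ _root_.commutator G' := by
  rw [Subgroup.map_sup, commutator_def, map_commutator, map_top_of_surjective f hf, commutator_def]

theorem isFiniteRelIndex_commutator {A B H : Subgroup G} (hfg : ⁅A, B⁆.FG)
    (hAB : ⁅A, B⁆ ≤ center G) (hH : (H ⊔ center G).FiniteIndex) :
    H.IsFiniteRelIndex ⁅A, B⁆ := by
  have : Group.FG (⁅A, B⁆ : Subgroup G) := (Group.fg_iff_subgroup_fg _).2 hfg
  have : IsMulCommutative (⁅A, B⁆ : Subgroup G) :=
    le_centralizer_iff_isMulCommutative.1 (hAB.trans (center_le_centralizer _))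
  rw [isFiniteRelIndex_iff_finiteIndex]
  refine finiteIndex_of_pow_mem_of_commutator_le (by simp [commutator_eq_bot])
    (closure_closure_coe_preimage (k := {g | ∃ x ∈ A, ∃ y ∈ B, ⁅x, y⁆ = g})) ?_
  rintro ⟨_, hc⟩ ⟨x, -, y, -, rfl⟩
  obtain ⟨m, hm, -, hxm⟩ := exists_pow_mem_of_index_ne_zero hH.index_ne_zero x
  obtain ⟨n, hn, -, hyn⟩ := exists_pow_mem_of_index_ne_zero hH.index_ne_zero y
  refine ⟨m * n, mul_pos hm hn, ?_⟩
  rw [mem_subgroupOf, SubmonoidClass.coe_pow,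
    ← commutatorElement_pow_pow_of_mem_center (hAB hc)]
  exact commutator_le_of_le_sup_center (zpowers_le.2 hxm) (zpowers_le.2 hyn)
    (commutator_mem_commutator (mem_zpowers _) (mem_zpowers _))

theorem finiteIndex_of_finiteIndex_sup_commutator [Group.FG G] [Group.IsNilpotent G]
    {H : Subgroup G} (hH : (H ⊔ _root_.commutator G).FiniteIndex) : H.FiniteIndex := by
  refine nilpotent_commutator_quotient_ind (P := fun G _ => Group.FG G → Group.IsNilpotent G →
      ∀ H : Subgroup G, (H ⊔ _root_.commutator G).FiniteIndex → H.FiniteIndex)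
    (fun G _ hG _ _ H hH => ?_) (fun G _ A _ hA ih _ _ H hH => ?_)
    G inferInstance inferInstance H hH
  · rwa [hG, sup_bot_eq] at hH
  · let q := QuotientGroup.mk' ⁅A, (⊤ : Subgroup G)⁆
    have hq : Function.Surjective q := QuotientGroup.mk'_surjective _
    have hmap : (H.map q ⊔ _root_.commutator (G ⧸ ⁅A, (⊤ : Subgroup G)⁆)).FiniteIndex := by
      rw [← map_sup_commutator hq]
      exact ⟨ne_zero_of_dvd_ne_zero hH.index_ne_zero (index_map_dvd _ hq)⟩
    have hsup : (H ⊔ ⁅A, ⊤⁆).FiniteIndex := by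
      have := ih inferInstance inferInstance _ hmap
      rw [← QuotientGroup.ker_mk' ⁅A, (⊤ : Subgroup G)⁆, ← comap_map_eq, finiteIndex_iff,
        index_comap_of_surjective _ hq]
      exact this.index_ne_zero
    have hcenter : (H ⊔ center G).FiniteIndex := finiteIndex_of_le (sup_le_sup_left hA H)
    have := isFiniteRelIndex_commutator (subgroup_fg_of_isNilpotent _) hA hcenter
    refine ⟨?_⟩
    rw [sup_comm] at hsup
    rw [← relIndex_mul_index (le_sup_right : H ≤ ⁅A, ⊤⁆ ⊔ H),
      relIndex_sup_of_le_normalizer (hA.trans (center_le_normalizer _))]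
    exact mul_ne_zero relIndex_ne_zero hsup.index_ne_zero

theorem finiteIndex_of_pow_mem_of_closure_eq_top [Group.FG G] [Group.IsNilpotent G]
    {H : Subgroup G} {S : Set G} (hS : Subgroup.closure S = ⊤)
    (h : ∀ s ∈ S, ∃ m : ℕ, 0 < m ∧ s ^ m ∈ H) : H.FiniteIndex :=
  finiteIndex_of_finiteIndex_sup_commutator <|
    finiteIndex_of_pow_mem_of_commutator_le le_sup_right hS fun s hs =>
      (h s hs).imp fun _ hm => ⟨hm.1, mem_sup_left hm.2⟩

theorem isFiniteRelIndex_closure_setOf_pow_mem [Group.FG G] [Group.IsNilpotent G]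
    (H : Subgroup G) :
    H.IsFiniteRelIndex (Subgroup.closure {g | ∃ m : ℕ, 0 < m ∧ g ^ m ∈ H}) := by
  set S : Set G := {g | ∃ m : ℕ, 0 < m ∧ g ^ m ∈ H}
  have : Group.FG (Subgroup.closure S) :=
    (Group.fg_iff_subgroup_fg _).2 (subgroup_fg_of_isNilpotent _)
  rw [isFiniteRelIndex_iff_finiteIndex]
  exact finiteIndex_of_pow_mem_of_closure_eq_top closure_closure_coe_preimage fun _ hs => hs

theorem rootClosed_closure_setOf_pow_mem {H : Subgroup G}
    [H.IsFiniteRelIndex (Subgroup.closure {g | ∃ m : ℕ, 0 < m ∧ g ^ m ∈ H})] :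
    RootClosed (Subgroup.closure {g | ∃ m : ℕ, 0 < m ∧ g ^ m ∈ H}) := by
  intro g i hi hg
  obtain ⟨m, hm, -, hgm⟩ := exists_pow_mem_of_relIndex_ne_zero (H := H) relIndex_ne_zero hg
  exact subset_closure ⟨i * m, mul_pos hi hm, by rw [pow_mul]; exact hgm.1⟩

theorem isFiniteRelIndex_isolator [Group.FG G] [Group.IsNilpotent G] (H : Subgroup G) :
    H.IsFiniteRelIndex (isolator H) := by
  have := isFiniteRelIndex_closure_setOf_pow_mem H
  have hH : H ≤ Subgroup.closure {g | ∃ m : ℕ, 0 < m ∧ g ^ m ∈ H} :=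
    fun x hx => subset_closure ⟨1, one_pos, by simpa using hx⟩
  exact isFiniteRelIndex_of_le_right H
    ((isolator_isLeast H).2 ⟨hH, rootClosed_closure_setOf_pow_mem⟩)

end NilpotentGroups

section BoundedIndex

variable {G : Type*} [Group G]

theorem finite_monoidHom_of_fg {M : Type*} [Monoid M] [Finite M] [Group.FG G] :
    Finite (G →* M) := by
  obtain ⟨S, hS⟩ := Group.fg_def.1 ‹Group.FG G›
  refine Finite.of_injective (fun (f : G →* M) (s : S) => f s) fun f g hfg => ?_
  exact MonoidHom.eq_of_eqOn_dense hS fun s hs => congrFun hfg ⟨s, hs⟩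

theorem exists_comap_stabilizer_eq (H : Subgroup G) [H.FiniteIndex] :
    ∃ (f : G →* Equiv.Perm (Fin H.index)) (i : Fin H.index),
      (MulAction.stabilizer (Equiv.Perm (Fin H.index)) i).comap f = H := by
  let e : G ⧸ H ≃ Fin H.index := Finite.equivFin _
  refine ⟨e.permCongrHom.toMonoidHom.comp (MulAction.toPermHom G (G ⧸ H)), e (1 : G), ?_⟩
  ext g
  simpa using (QuotientGroup.eq (s := H) (a := g) (b := 1)).trans (by simp)

theorem finite_setOf_index_eq [Group.FG G] {n : ℕ} (hn : n ≠ 0) :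
    {H : Subgroup G | H.index = n}.Finite := by
  have : Finite (G →* Equiv.Perm (Fin n)) := finite_monoidHom_of_fg
  refine (Set.finite_range fun p : (G →* Equiv.Perm (Fin n)) × Fin n =>
    (MulAction.stabilizer (Equiv.Perm (Fin n)) p.2).comap p.1).subset ?_
  rintro H rfl
  have : H.FiniteIndex := ⟨hn⟩
  obtain ⟨f, i, hH⟩ := exists_comap_stabilizer_eq H
  exact ⟨(f, i), hH⟩

theorem finite_setOf_relIndex_le {K : Subgroup G} (hK : K.FG) (n : ℕ) :
    {H : Subgroup G | H ≤ K ∧ H.IsFiniteRelIndex K ∧ H.relIndex K ≤ n}.Finite := by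
  have : Group.FG K := (Group.fg_iff_subgroup_fg K).2 hK
  have hfin : (⋃ m ∈ Set.Icc 1 n, {H : Subgroup K | H.index = m}).Finite :=
    (Set.finite_Icc 1 n).biUnion fun m hm => finite_setOf_index_eq (Nat.one_le_iff_ne_zero.1 hm.1)
  refine (hfin.image (Subgroup.map K.subtype)).subset ?_
  rintro H ⟨hHK, hfin, hn⟩
  refine ⟨H.subgroupOf K, ?_, by rw [subgroupOf_map_subtype, inf_of_le_left hHK]⟩
  exact Set.mem_biUnion ⟨Nat.one_le_iff_ne_zero.2 relIndex_ne_zero, hn⟩ rfl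

end BoundedIndex

section InducedCharacters

variable {G : Type*} [Group G]

theorem iSup_map_eq_top {k V : Type*} [Field k] [AddCommGroup V] [Module k V]
    (ρ : Representation k G V) [ρ.IsIrreducible] {U : Submodule k V} (hU : U ≠ ⊥) :
    ⨆ g, U.map (ρ g) = ⊤ := by
  let P : Subrepresentation ρ :=
    { toSubmodule := ⨆ g, U.map (ρ g)
      apply_mem_toSubmodule := fun x => by
        change (⨆ g, U.map (ρ g)) ≤ (⨆ g, U.map (ρ g)).comap (ρ x)
        refine iSup_le fun g => Submodule.map_le_iff_le_comap.1 ?_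
        rw [← Submodule.map_comp, ← Module.End.mul_eq_comp, ← map_mul]
        exact le_iSup (fun g => U.map (ρ g)) (x * g) }
  have hUP : U ≤ P.toSubmodule :=
    le_iSup_of_le 1 (by rw [map_one, Module.End.one_eq_id, Submodule.map_id])
  refine congrArg Subrepresentation.toSubmodule ((eq_bot_or_eq_top P).resolve_left fun hP => hU ?_)
  exact le_bot_iff.1 (hUP.trans_eq (congrArg Subrepresentation.toSubmodule hP))

open Classical in
/-- The realization of `ind_H^G(χ)` inside the coinduced representation: the functions `F` on `G`
with `F (h y) = χ h * F y` for `h ∈ H`, on which `G` acts by right translation. -/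
noncomputable def indToFun (H : Subgroup G) (χ : H →* ℂˣ) :
    Representation.IndV H.subtype (charRep χ) →ₗ[ℂ] (G → ℂ) :=
  (Representation.coindV H.subtype (charRep χ)).subtype ∘ₗ Rep.indToCoind (Rep.of (charRep χ))

/-- The generator `x⁻¹ ⊗ 1` of `ℂ[G] ⊗_{ℂ[H]} χ`. The inverse makes the corresponding function on
`G` supported on the coset `H x`. -/
noncomputable def gen (H : Subgroup G) (χ : H →* ℂˣ) (x : G) :
    Representation.IndV H.subtype (charRep χ) :=
  Representation.IndV.mk H.subtype (charRep χ) x 1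

variable {H : Subgroup G} {χ : H →* ℂˣ}

theorem span_range_gen : Submodule.span ℂ (Set.range (gen H χ)) = ⊤ := by
  rw [← Submodule.ker_mkQ (Submodule.span ℂ (Set.range (gen H χ))), LinearMap.ker_eq_top]
  ext x
  exact (Submodule.Quotient.mk_eq_zero _).2 (Submodule.subset_span ⟨x, rfl⟩)

theorem indChar_gen (g x : G) : indChar H χ g (gen H χ x) = gen H χ (x * g⁻¹) :=
  Representation.ind_mk _ _ _ _ _

theorem smul_gen_mul_left (h : H) (x : G) : (χ h : ℂ) • gen H χ (h * x) = gen H χ x := by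
  have hmk := Representation.Coinvariants.mk_self_apply (Representation.tprod
    ((Representation.leftRegular ℂ G).comp H.subtype) (charRep χ)) h
    (MonoidAlgebra.single x 1 ⊗ₜ 1)
  rw [gen, gen, ← map_smul, show (χ h : ℂ) • (1 : ℂ) = charRep χ h 1 from rfl]
  exact Eq.trans (by simp) hmk

theorem indChar_gen_one (h : H) : indChar H χ h (gen H χ 1) = (χ h : ℂ) • gen H χ 1 := by
  rw [indChar_gen, ← smul_gen_mul_left h (1 * (h : G)⁻¹), one_mul, mul_inv_cancel]

theorem indToFun_mul_left (v : Representation.IndV H.subtype (charRep χ)) (h : H) (y : G) :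
    indToFun H χ v (h * y) = χ h * indToFun H χ v y := by
  classical
  exact (Rep.indToCoind (Rep.of (charRep χ)) v).2 h y

open Classical in
theorem indToFun_gen (x : G) :
    indToFun H χ (gen H χ x) = Rep.indToCoindAux (Rep.of (charRep χ)) x (1 : ℂ) := by
  ext y
  simp only [indToFun, gen, LinearMap.comp_apply, Submodule.subtype_apply]
  simp [LinearMap.codRestrict]

theorem indToFun_gen_self (x : G) : indToFun H χ (gen H χ x) x = 1 := by
  classical
  rw [indToFun_gen]
  exact Rep.indToCoindAux_self (A := Rep.of (charRep χ)) x (1 : ℂ)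

theorem indToFun_gen_of_notMem {x y : G} (hxy : x * y⁻¹ ∉ H) : indToFun H χ (gen H χ x) y = 0 := by
  classical
  rw [indToFun_gen]
  exact Rep.indToCoindAux_of_not_rel _ _ _ (mt QuotientGroup.rightRel_apply.1 hxy)

theorem indToFun_indChar (g : G) (v : Representation.IndV H.subtype (charRep χ)) (y : G) :
    indToFun H χ (indChar H χ g v) y = indToFun H χ v (y * g) := by
  classical
  have heq : LinearMap.proj y ∘ₗ indToFun H χ ∘ₗ indChar H χ g =
      LinearMap.proj (y * g) ∘ₗ indToFun H χ := by
    refine LinearMap.ext_on_range span_range_gen fun x => ?_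
    simp only [LinearMap.comp_apply, LinearMap.proj_apply, indChar_gen, indToFun_gen]
    exact Rep.indToCoindAux_fst_mul_inv (A := Rep.of (charRep χ)) x g y (1 : ℂ)
  exact LinearMap.congr_fun heq v

theorem linearIndependent_indToFun_gen {ι : Type*} {x : ι → G}
    (hx : Pairwise fun i j => x i * (x j)⁻¹ ∉ H) :
    LinearIndependent ℂ fun i => indToFun H χ (gen H χ (x i)) := by
  refine linearIndependent_iff'.2 fun s c hc j hj => ?_
  have hcj := congrFun hc (x j)
  rw [Finset.sum_apply, Finset.sum_eq_single_of_mem j hj fun i _ hij => ?_] at hcj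
  · simpa [indToFun_gen_self] using hcj
  · rw [Pi.smul_apply, indToFun_gen_of_notMem (hx hij), smul_zero]

theorem linearIndependent_gen {ι : Type*} {x : ι → G}
    (hx : Pairwise fun i j => x i * (x j)⁻¹ ∉ H) :
    LinearIndependent ℂ fun i => gen H χ (x i) :=
  (linearIndependent_indToFun_gen hx).of_comp (indToFun H χ)

theorem indToFun_injective : Function.Injective (indToFun H χ) := by
  let rep : Quotient (QuotientGroup.rightRel H) → G := Quotient.out
  have hspan : Submodule.span ℂ (Set.range fun q => gen H χ (rep q)) = ⊤ := by
    refine eq_top_iff.2 (span_range_gen.ge.trans (Submodule.span_le.2 ?_))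
    rintro _ ⟨x, rfl⟩
    have hmem : rep (Quotient.mk _ x) * x⁻¹ ∈ H :=
      QuotientGroup.rightRel_apply.1 (Setoid.symm' _ (Quotient.mk_out x))
    rw [SetLike.mem_coe, ← smul_gen_mul_left ⟨_, hmem⟩, inv_mul_cancel_right]
    exact Submodule.smul_mem _ _ (Submodule.subset_span ⟨_, rfl⟩)
  refine LinearMap.injective_of_linearIndependent hspan
    (linearIndependent_indToFun_gen fun p q hpq hmem => hpq ?_)
  rw [← Quotient.out_eq p, ← Quotient.out_eq q]
  exact (Quotient.sound (QuotientGroup.rightRel_apply.2 hmem)).symm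

theorem finite_support_indToFun (v : Representation.IndV H.subtype (charRep χ)) :
    (Quotient.mk (QuotientGroup.rightRel H) '' (indToFun H χ v).support).Finite := by
  have hv : v ∈ Submodule.span ℂ (Set.range (gen H χ)) := span_range_gen.ge Submodule.mem_top
  induction hv using Submodule.span_induction with
  | mem _ hgen =>
    obtain ⟨x, rfl⟩ := hgen
    refine (Set.finite_singleton (Quotient.mk (QuotientGroup.rightRel H) x)).subset ?_
    rintro _ ⟨y, hy, rfl⟩
    refine Quotient.sound (QuotientGroup.rightRel_apply.2 ?_)
    by_contra hxy
    exact hy (indToFun_gen_of_notMem hxy)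
  | zero => simp
  | add v w _ _ hv hw =>
    rw [map_add]
    refine (hv.union hw).subset ?_
    rw [← Set.image_union]
    exact Set.image_mono (Function.support_add _ _)
  | smul c v _ hv =>
    rw [map_smul]
    exact hv.subset (Set.image_mono (Function.support_const_smul_subset _ _))

/-- The vectors of `ind_H^G(χ)` whose associated functions on `G` vanish outside `K`. For
`H ≤ K` they form a copy of `ind_H^K(χ)`. -/
noncomputable def supportedOn (χ : H →* ℂˣ) (K : Subgroup G) :
    Submodule ℂ (Representation.IndV H.subtype (charRep χ)) :=
  LinearMap.ker (LinearMap.funLeft ℂ ℂ ((↑) : {y // y ∉ K} → G) ∘ₗ indToFun H χ)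

theorem mem_supportedOn {K : Subgroup G} {v : Representation.IndV H.subtype (charRep χ)} :
    v ∈ supportedOn χ K ↔ ∀ y ∉ K, indToFun H χ v y = 0 := by
  simp [supportedOn, funext_iff]

theorem gen_mem_supportedOn {K : Subgroup G} (hHK : H ≤ K) {x : G} (hx : x ∈ K) :
    gen H χ x ∈ supportedOn χ K :=
  mem_supportedOn.2 fun _ hy => indToFun_gen_of_notMem fun hxy =>
    hy (inv_mem_iff.1 ((K.mul_mem_cancel_left hx).1 (hHK hxy)))

theorem indChar_mem_supportedOn {K : Subgroup G} {v : Representation.IndV H.subtype (charRep χ)}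
    (hv : v ∈ supportedOn χ K) {x : G} (hx : x ∈ K) : indChar H χ x v ∈ supportedOn χ K :=
  mem_supportedOn.2 fun y hy => by
    rw [indToFun_indChar, mem_supportedOn.1 hv]
    rwa [K.mul_mem_cancel_right hx]

theorem gen_one_mem_of_ne_bot [(indChar H χ).IsIrreducible] {K : Subgroup G} (hHK : H ≤ K)
    {U : Submodule ℂ (Representation.IndV H.subtype (charRep χ))} (hU : U ≤ supportedOn χ K)
    (hUK : ∀ x ∈ K, ∀ u ∈ U, indChar H χ x u ∈ U) (hU0 : U ≠ ⊥) : gen H χ 1 ∈ U := by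
  let res : Representation.IndV H.subtype (charRep χ) →ₗ[ℂ] (K → ℂ) :=
    LinearMap.funLeft ℂ ℂ ((↑) : K → G) ∘ₗ indToFun H χ
  have hres : ⊤ ≤ (U.map res).comap res := by
    -- The translates of `U` by elements outside `K` vanish on `K`.
    rw [← iSup_map_eq_top (indChar H χ) hU0]
    refine iSup_le fun x => Submodule.map_le_iff_le_comap.2 fun u hu => ?_
    by_cases hx : x ∈ K
    · exact Submodule.mem_map_of_mem (hUK x hx u hu)
    · have hxu : res (indChar H χ x u) = 0 := funext fun y =>
        (indToFun_indChar x u y).trans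
          (mem_supportedOn.1 (hU hu) _ (by rwa [K.mul_mem_cancel_left y.2]))
      rw [Submodule.mem_comap, Submodule.mem_comap, hxu]
      exact zero_mem _
  obtain ⟨u, hu, hures⟩ := hres (Submodule.mem_top (x := gen H χ 1))
  suffices u = gen H χ 1 from this ▸ hu
  refine indToFun_injective (funext fun y => ?_)
  by_cases hy : y ∈ K
  · exact congrFun hures ⟨y, hy⟩
  · rw [mem_supportedOn.1 (hU hu) y hy,
      mem_supportedOn.1 (gen_mem_supportedOn hHK K.one_mem) y hy]

theorem indToFun_eq_zero_of_forall_out {K : Subgroup G}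
    {v : Representation.IndV H.subtype (charRep χ)} {g : G}
    (hv : ∀ q : K ⧸ H.subgroupOf K, indToFun H χ v ((q.out : G)⁻¹ * g) = 0) (k : K) :
    indToFun H χ v (k * g) = 0 := by
  let r : K := (QuotientGroup.mk k⁻¹ : K ⧸ H.subgroupOf K).out
  have hr : k * r ∈ H.subgroupOf K := by
    simpa [r] using QuotientGroup.eq.1 (QuotientGroup.out_eq' (QuotientGroup.mk k⁻¹)).symm
  have hkr := indToFun_mul_left v ⟨_, mem_subgroupOf.1 hr⟩ ((r : G)⁻¹ * g)
  rwa [hv, mul_zero, ← mul_assoc, K.coe_mul, mul_inv_cancel_right] at hkr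

variable {H' : Subgroup G} {χ' : H' →* ℂˣ}
  (f : (indChar H' χ').IntertwiningMap (indChar H χ))

theorem indToFun_map_gen_one_mul (h : H') (y : G) :
    indToFun H χ (f (gen H' χ' 1)) (y * h) = χ' h * indToFun H χ (f (gen H' χ' 1)) y := by
  rw [← indToFun_indChar, ← f.isIntertwining, indChar_gen_one, map_smul, map_smul, Pi.smul_apply,
    smul_eq_mul]

variable {f} {g : G} {K : Subgroup G}

theorem exists_conj_pow_mem (hg : indToFun H χ (f (gen H' χ' 1)) g ≠ 0) {h : G} (hh : h ∈ H') :
    ∃ n : ℕ, 0 < n ∧ g * h ^ n * g⁻¹ ∈ H := by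
  have hmaps : Set.MapsTo (fun n : ℕ => Quotient.mk (QuotientGroup.rightRel H) (g * h ^ n))
      Set.univ (Quotient.mk _ '' (indToFun H χ (f (gen H' χ' 1))).support) := fun n _ => by
    refine Set.mem_image_of_mem _ ?_
    have hn := indToFun_map_gen_one_mul f (⟨h, hh⟩ ^ n) g
    exact hn.trans_ne (mul_ne_zero (Units.ne_zero _) hg)
  obtain ⟨i, -, j, -, hij, heq⟩ :=
    Set.infinite_univ.exists_lt_map_eq_of_mapsTo hmaps (finite_support_indToFun _)
  refine ⟨j - i, Nat.sub_pos_of_lt hij, ?_⟩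
  have hmem : g * h ^ j * (g * h ^ i)⁻¹ ∈ H := QuotientGroup.rightRel_apply.1 (Quotient.exact heq)
  rwa [mul_inv_rev, mul_assoc, ← mul_assoc (h ^ j), ← pow_sub h hij.le, ← mul_assoc] at hmem

theorem conj_mem_of_rootClosed (hHK : H ≤ K) (hK : RootClosed K)
    [H'.IsFiniteRelIndex K] (hg : indToFun H χ (f (gen H' χ' 1)) g ≠ 0) {k : G} (hk : k ∈ K) :
    g * k * g⁻¹ ∈ K := by
  obtain ⟨m, hm, -, hkm⟩ := exists_pow_mem_of_relIndex_ne_zero (H := H') relIndex_ne_zero hk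
  obtain ⟨n, hn, hmn⟩ := exists_conj_pow_mem hg hkm.1
  refine hK _ (m * n) (mul_pos hm hn) ?_
  rw [conj_pow, pow_mul]
  exact hHK hmn

theorem eq_zero_of_mem_supportedOn [(indChar H' χ').IsIrreducible] (hH'K : H' ≤ K)
    (hconj : ∀ k ∈ K, g * k * g⁻¹ ∈ K) (hg : indToFun H χ (f (gen H' χ' 1)) g ≠ 0)
    {u : Representation.IndV H'.subtype (charRep χ')} (hu : u ∈ supportedOn χ' K)
    (hfu : ∀ k : K, indToFun H χ (f u) (k * g) = 0) : u = 0 := by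
  let resCoset : Representation.IndV H'.subtype (charRep χ') →ₗ[ℂ] (K → ℂ) :=
    LinearMap.funLeft ℂ ℂ (fun k : K => (k * g : G)) ∘ₗ indToFun H χ ∘ₗ f.toLinearMap
  suffices supportedOn χ' K ⊓ LinearMap.ker resCoset = ⊥ from
    (Submodule.eq_bot_iff _).1 this u ⟨hu, funext hfu⟩
  by_contra hne
  have hgen := gen_one_mem_of_ne_bot hH'K inf_le_left ?_ hne
  · exact hg ((congrArg _ (one_mul g)).symm.trans (congrFun hgen.2 (1 : K)))
  · rintro x hx v ⟨hv, hfv⟩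
    refine ⟨indChar_mem_supportedOn hv hx, funext fun k => ?_⟩
    have hkx : (k * g * x : G) = (k * ⟨g * x * g⁻¹, hconj x hx⟩ : K) * g := by simp [mul_assoc]
    change indToFun H χ (f (indChar H' χ' x v)) (k * g) = 0
    rw [f.isIntertwining, indToFun_indChar, hkx]
    exact congrFun hfv _

theorem exists_indToFun_map_gen_one_ne_zero (hf : Function.Injective f) :
    ∃ g, indToFun H χ (f (gen H' χ' 1)) g ≠ 0 := by
  refine Function.ne_iff.1 fun h0 => ?_
  have hgen : gen H' χ' 1 = 0 := hf (indToFun_injective (by rw [map_zero, map_zero]; exact h0))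
  have hone := indToFun_gen_self (χ := χ') 1
  rw [hgen, map_zero] at hone
  exact zero_ne_one hone

theorem relIndex_le_of_injective [(indChar H' χ').IsIrreducible] (hHK : H ≤ K) (hH'K : H' ≤ K)
    (hK : RootClosed K) [H.IsFiniteRelIndex K] [H'.IsFiniteRelIndex K]
    (hf : Function.Injective f) : H'.relIndex K ≤ H.relIndex K := by
  obtain ⟨g, hg⟩ := exists_indToFun_map_gen_one_ne_zero hf
  have : Fintype (K ⧸ H.subgroupOf K) := Fintype.ofFinite _
  have : Fintype (K ⧸ H'.subgroupOf K) := Fintype.ofFinite _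
  let rep (q : K ⧸ H'.subgroupOf K) : G := (q.out : G)⁻¹
  have hrep : Pairwise fun p q => rep p * (rep q)⁻¹ ∉ H' := fun p q hpq hmem => hpq <| by
    rw [← QuotientGroup.out_eq' p, ← QuotientGroup.out_eq' q]
    exact QuotientGroup.eq.2 (mem_subgroupOf.2 (by simpa [rep] using hmem))
  have hspan : Submodule.span ℂ (Set.range fun q => gen H' χ' (rep q)) ≤ supportedOn χ' K := by
    rw [Submodule.span_le]
    rintro _ ⟨q, rfl⟩
    exact gen_mem_supportedOn hH'K (K.inv_mem q.out.2)
  let ev : Representation.IndV H'.subtype (charRep χ') →ₗ[ℂ] (K ⧸ H.subgroupOf K → ℂ) :=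
    LinearMap.funLeft ℂ ℂ (fun q : K ⧸ H.subgroupOf K => (q.out : G)⁻¹ * g) ∘ₗ indToFun H χ ∘ₗ
      f.toLinearMap
  have hdisj : Disjoint (supportedOn χ' K) (LinearMap.ker ev) :=
    Submodule.disjoint_def.2 fun u hu hev =>
      eq_zero_of_mem_supportedOn hH'K (fun k hk => conj_mem_of_rootClosed hHK hK hg hk) hg hu
        (indToFun_eq_zero_of_forall_out fun q => congrFun (LinearMap.mem_ker.1 hev) q)
  have hcard := ((linearIndependent_gen hrep).map (hdisj.mono_left hspan)).fintype_card_le_finrank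
  rwa [Module.finrank_fintype_fun_eq_card, ← Nat.card_eq_fintype_card,
    ← Nat.card_eq_fintype_card] at hcard

end InducedCharacters

section Fibres

variable {G : Type*} [Group G]

theorem le_isolator (H : Subgroup G) : H ≤ isolator H :=
  (isolator_isLeast H).1.1

theorem rootClosed_isolator (H : Subgroup G) : RootClosed (isolator H) :=
  (isolator_isLeast H).1.2

theorem relIndex_isolator_le_of_equivalent {p q : Y G} (hpq : Equivalent q p)
    (hiso : isolator q.subgroup = isolator p.subgroup)
    [p.subgroup.IsFiniteRelIndex (isolator p.subgroup)]
    [q.subgroup.IsFiniteRelIndex (isolator p.subgroup)] :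
    q.subgroup.relIndex (isolator p.subgroup) ≤ p.subgroup.relIndex (isolator p.subgroup) := by
  obtain ⟨e⟩ := hpq
  have := q.irreducible
  exact relIndex_le_of_injective (f := e.toIntertwiningMap) (le_isolator _)
    (hiso ▸ le_isolator q.subgroup) (rootClosed_isolator _) e.injective

theorem phi_mk_eq_mk_iff {H : Base G} {q : YFibre H} {p : Y G} :
    phi ⟨H, Quotient.mk (fibreSetoid H) q⟩ = Quotient.mk (starSetoid G) p ↔
      Equivalent q.1 p ∧ isolator q.1.subgroup = isolator p.subgroup :=
  Quotient.eq (r := starSetoid G)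

theorem injOn_fst_preimage_phi (w : W G) : Set.InjOn Sigma.fst (phi ⁻¹' {w} : Set (Z G)) := by
  rintro ⟨H, a⟩ ha ⟨H', b⟩ hb h
  obtain rfl : H = H' := h
  induction a using Quotient.inductionOn with | _ p
  induction b using Quotient.inductionOn with | _ q
  have hpq := phi_mk_eq_mk_iff.1 ((show phi _ = w from ha).trans (show phi _ = w from hb).symm)
  rw [Quotient.sound (s := fibreSetoid H) hpq.1]

end Fibres

end WeightPairs

open WeightPairs in
theorem mainTheorem10_general {G : Type*} [Group G] (hfg : ∀ H : Subgroup G, (isolator H).FG)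
    (hfin : ∀ H : Subgroup G, H.IsFiniteRelIndex (isolator H)) (w : W G) :
    (phi ⁻¹' {w}).Finite := by
  induction w using Quotient.inductionOn with | _ p
  refine Set.Finite.of_finite_image ?_ (injOn_fst_preimage_phi _)
  refine Set.Finite.of_finite_image (f := Subtype.val) ?_ Subtype.val_injective.injOn
  refine (finite_setOf_relIndex_le (hfg p.subgroup)
    (p.subgroup.relIndex (isolator p.subgroup))).subset ?_
  rintro _ ⟨_, ⟨⟨H, a⟩, ha, rfl⟩, rfl⟩
  induction a using Quotient.inductionOn with | _ q
  obtain ⟨q, rfl⟩ := q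
  obtain ⟨hqp, hiso⟩ := phi_mk_eq_mk_iff.1 ha
  have hp := hfin p.subgroup
  have hq : q.subgroup.IsFiniteRelIndex (isolator p.subgroup) := hiso ▸ hfin q.subgroup
  exact ⟨hiso ▸ le_isolator q.subgroup, hq, relIndex_isolator_le_of_equivalent hqp hiso⟩

theorem mainTheorem10 (G : Type*) [Group G] [Group.FG G] [Group.IsNilpotent G]
    (w : WeightPairs.W G) : (WeightPairs.phi ⁻¹' {w}).Finite :=
  mainTheorem10_general (fun _ => WeightPairs.subgroup_fg_of_isNilpotent _)
    WeightPairs.isFiniteRelIndex_isolator w
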